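/- All rings are associative with non-zero identity. A ring $R$ with center $C(R)$ is *centrally essential* if for every non-zero $a\in R$ there are non-zero $x,y\in C(R)$ with $ax=y$; it is *right invariant* if every right ideal of $R$ is a two-sided ideal. An Abelian group $A$ is *faithful* if $IA\neq A$ for every proper right ideal $I$ of its endomorphism ring $\operatorname{End}A$, where endomorphisms act on $A$ from the left and $IA$ is the subgroup generated by all $f(a)$ with $f\in I$, $a\in A$. For $n\ge 7$ let $\mathcal R_n$ be the subring of $M_n(\mathbb Z)$ consisting of all matrices $(x_{ij})$ with first row $(\alpha,a_{12},a_{13},\dots,a_{1n})$, where $\alpha,a_{12},\dots,a_{1n}\in\mathbb Z$ are arbitrary, with $x_{ii}=\alpha$ for all $i$, with $x_{24}=a_{13}$, $x_{2n}=a_{1,n-2}$, $x_{3n}=a_{1,n-1}$, $x_{n-2,n}=a_{12}$, $x_{n-1,n}=a_{13}$, and with all other entries equal to $0$. **Corollary 4.4.** For every integer $n\ge 7$ there exists a faithful torsion-free Abelian group $A$ of rank $n$ such that the ring $\operatorname{End}A$ is centrally essential and not right invariant, and such that $\operatorname{End}A\cong\mathcal R_n$ as rings. -/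

import Mathlib

/-- A ring is centrally essential if for every nonzero `a` there are nonzero central elements
`x`, `y` with `a * x = y`. -/
def IsCentrallyEssential (R : Type*) [Ring R] : Prop :=
  ∀ a : R, a ≠ 0 → ∃ x ∈ Subring.center R, ∃ y ∈ Subring.center R, x ≠ 0 ∧ y ≠ 0 ∧ a * x = y

/-- A ring is right invariant if every right ideal (an `Rᵐᵒᵖ`-submodule of `R`) is an ideal,
that is, is also closed under multiplication from the left. -/
def IsRightInvariant (R : Type*) [Ring R] : Prop :=
  ∀ I : Submodule Rᵐᵒᵖ R, ∀ r x : R, x ∈ I → r * x ∈ I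

/-- For a right ideal `I` of the endomorphism ring of `A`, the subgroup `IA` of `A`, consisting
of the finite sums of elements `f a` with `f ∈ I` and `a ∈ A`. -/
def rightIdealImage {A : Type*} [AddCommGroup A]
    (I : Submodule (AddMonoid.End A)ᵐᵒᵖ (AddMonoid.End A)) : AddSubgroup A :=
  AddSubgroup.closure {b | ∃ f ∈ I, ∃ a : A, f a = b}

/-- An Abelian group `A` is faithful if `IA ≠ A` for every proper right ideal `I` of `End A`. -/
def IsFaithfulAbelianGroup (A : Type*) [AddCommGroup A] : Prop :=
  ∀ I : Submodule (AddMonoid.End A)ᵐᵒᵖ (AddMonoid.End A), I ≠ ⊤ → rightIdealImage I ≠ ⊤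

/-- The entries (rows and columns are numbered from `0`) of the `n × n` matrix with first row
`v 0, v 1, …, v (n - 1)`, all diagonal entries `v 0`, five further entries repeated from the
first row, and zeros elsewhere. -/
def patternEntry {R : Type*} [Zero R] (n : ℕ) (v : ℕ → R) (i j : ℕ) : R :=
  if i = j then v 0
  else if i = 0 then v j
  else if i = 1 ∧ j = 3 then v 2
  else if i = 1 ∧ j = n - 1 then v (n - 3)
  else if i = 2 ∧ j = n - 1 then v (n - 2)
  else if i = n - 3 ∧ j = n - 1 then v 1
  else if i = n - 2 ∧ j = n - 1 then v 2
  else 0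

/-- The `n × n` matrix with the entries `patternEntry n v`. -/
def patternMatrix {R : Type*} [Zero R] (n : ℕ) (v : ℕ → R) : Matrix (Fin n) (Fin n) R :=
  Matrix.of fun i j => patternEntry n v i j

theorem patternEntry_diag {R : Type*} [Zero R] (n : ℕ) (v : ℕ → R) (i : ℕ) :
    patternEntry n v i i = v 0 := if_pos rfl

theorem patternEntry_first_row {R : Type*} [Zero R] (n : ℕ) (v : ℕ → R) (j : ℕ) :
    patternEntry n v 0 j = v j := by
  unfold patternEntry
  by_cases h : 0 = j
  · rw [if_pos h, h]
  · rw [if_neg h, if_pos rfl]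

theorem patternEntry_eq_zero {R : Type*} [Zero R] (n : ℕ) (v : ℕ → R) (i j : ℕ) (hi : 0 < i)
    (hij : i ≠ j) (h3 : ¬(i = 1 ∧ j = 3))
    (hl : ¬(j = n - 1 ∧ (i = 1 ∨ i = 2 ∨ i = n - 3 ∨ i = n - 2))) :
    patternEntry n v i j = 0 := by
  unfold patternEntry
  rw [if_neg hij, if_neg (by omega), if_neg h3, if_neg (by omega), if_neg (by omega),
    if_neg (by omega), if_neg (by omega)]

theorem patternMatrix_mul {R : Type*} [CommRing R] {n : ℕ} (hn : 7 ≤ n) (v w : ℕ → R) :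
    ∃ u : ℕ → R, patternMatrix n v * patternMatrix n w = patternMatrix n u := by
  obtain ⟨u, hu⟩ : ∃ u : ℕ → R, ∀ j,
      ∑ k ∈ Finset.range n, patternEntry n v 0 k * patternEntry n w k j = u j :=
    ⟨_, fun _ => rfl⟩
  -- an entry all of whose contributions come from the indices `i` and `j`
  have two : ∀ i j, i < n → j < n → i ≠ j →
      (∀ k, k ≠ i → k ≠ j → patternEntry n v i k * patternEntry n w k j = 0) →
      ∑ k ∈ Finset.range n, patternEntry n v i k * patternEntry n w k j =
        v 0 * patternEntry n w i j + patternEntry n v i j * w 0 := by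
    intro i j hi hj hij h
    rw [← Finset.sum_subset (s₁ := {i, j}), Finset.sum_pair hij, patternEntry_diag,
      patternEntry_diag]
    · intro k hk
      simp only [Finset.mem_insert, Finset.mem_singleton] at hk
      rw [Finset.mem_range]
      omega
    · intro k _ hk
      simp only [Finset.mem_insert, Finset.mem_singleton, not_or] at hk
      exact h k hk.1 hk.2
  have diag : ∀ i, i < n → (∀ k, k ≠ i → patternEntry n v i k * patternEntry n w k i = 0) →
      ∑ k ∈ Finset.range n, patternEntry n v i k * patternEntry n w k i = v 0 * w 0 := by
    intro i hi h
    rw [Finset.sum_eq_single i (fun k _ hk => h k hk)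
      (fun hk => absurd (Finset.mem_range.2 hi) hk), patternEntry_diag, patternEntry_diag]
  have u0 : u 0 = v 0 * w 0 := by
    rw [← hu]
    refine diag 0 (by omega) fun k hk => ?_
    rw [patternEntry_eq_zero n w k 0 (by omega) hk (by omega) (by omega), mul_zero]
  have col : ∀ j, 0 < j → j < n - 1 → j ≠ 3 → u j = v 0 * w j + v j * w 0 := by
    intro j h0 h1 h3
    rw [← hu, two 0 j (by omega) (by omega) (by omega), patternEntry_first_row,
      patternEntry_first_row]
    intro k hk hkj
    rw [patternEntry_eq_zero n w k j (by omega) hkj (by omega) (by omega), mul_zero]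
  have prod : ∀ i j k, 0 < i → k ≠ i → k ≠ j →
      patternEntry n v i k * patternEntry n w k j = 0 := by
    intro i j k hi hki hkj
    by_cases hs : (i = 1 ∧ k = 3) ∨ (k = n - 1 ∧ (i = 1 ∨ i = 2 ∨ i = n - 3 ∨ i = n - 2))
    · rw [patternEntry_eq_zero n w k j (by omega) hkj (by omega) (by omega), mul_zero]
    · rw [patternEntry_eq_zero n v i k hi hki.symm (by omega) (by omega), zero_mul]
  refine ⟨u, ?_⟩
  ext i j
  obtain ⟨i, hi⟩ := i
  obtain ⟨j, hj⟩ := j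
  simp only [patternMatrix, Matrix.mul_apply, Matrix.of_apply]
  rw [Fin.sum_univ_eq_sum_range (fun k => patternEntry n v i k * patternEntry n w k j) n]
  rcases Nat.eq_zero_or_pos i with rfl | hi0
  · rw [hu, patternEntry_first_row]
  by_cases hij : i = j
  · subst hij
    rw [diag i hi fun k hk => prod i i k hi0 hk hk, patternEntry_diag, u0]
  rw [two i j hi hj hij fun k hk hkj => prod i j k hi0 hk hkj]
  have e1 := col 1 (by omega) (by omega) (by omega)
  have e2 := col 2 (by omega) (by omega) (by omega)
  have e3 := col (n - 3) (by omega) (by omega) (by omega)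
  have e4 := col (n - 2) (by omega) (by omega) (by omega)
  have hi' : i ≠ 0 := by omega
  simp only [patternEntry, if_neg hij, if_neg hi']
  split_ifs
  · exact e2.symm
  · exact e3.symm
  · exact e4.symm
  · exact e1.symm
  · exact e2.symm
  · rw [mul_zero, zero_mul, add_zero]

/-- The subring of `M_n(R)`, `n ≥ 7`, consisting of the matrices
```
α  a₁₂ a₁₃ a₁₄ a₁₅ … a₁,ₙ₋₂ a₁,ₙ₋₁ a₁ₙ
0  α   0   a₁₃ 0   … 0      0      a₁,ₙ₋₂
0  0   α   0   0   … 0      0      a₁,ₙ₋₁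
0  0   0   α   0   … 0      0      0
…
0  0   0   0   0   … α      0      a₁₂
0  0   0   0   0   … 0      α      a₁₃
0  0   0   0   0   … 0      0      α
```
-/
def patternRing (R : Type*) [CommRing R] (n : ℕ) (hn : 7 ≤ n) :
    Subring (Matrix (Fin n) (Fin n) R) where
  carrier := {A | ∃ v : ℕ → R, A = patternMatrix n v}
  mul_mem' := by
    rintro _ _ ⟨v, rfl⟩ ⟨w, rfl⟩
    exact patternMatrix_mul hn v w
  one_mem' := by
    refine ⟨fun k => if k = 0 then 1 else 0, ?_⟩
    ext i j
    simp only [patternMatrix, patternEntry, Matrix.of_apply, Matrix.one_apply, Fin.ext_iff]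
    split_ifs <;> first | rfl | (exfalso; omega)
  add_mem' := by
    rintro _ _ ⟨v, rfl⟩ ⟨w, rfl⟩
    refine ⟨v + w, ?_⟩
    ext i j
    simp only [patternMatrix, patternEntry, Matrix.of_apply, Matrix.add_apply, Pi.add_apply]
    split_ifs <;> simp
  zero_mem' := by
    refine ⟨0, ?_⟩
    ext i j
    simp [patternMatrix, patternEntry]
  neg_mem' := by
    rintro _ ⟨v, rfl⟩
    refine ⟨-v, ?_⟩
    ext i j
    simp only [patternMatrix, patternEntry, Matrix.of_apply, Matrix.neg_apply, Pi.neg_apply]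
    split_ifs <;> simp

/-! The ring is realized on a lattice that is locally free of rank one over it. Let `R` have free
additive group, spanned by 1 and square-zero elements `ν k`, and let `K = ℚ ⊗ R`. Give each `k`
infinitely many primes `p`, those with `c p = k`, and put `w p = p - ν (c p)`, which has inverse `(p
+ ν (c p)) / p²` in `K`. Let `A` be the group of all `x` in `K` with `x * w p` in `R_(p)` for every
`p`; it is a left `R`-module containing `R`.

Endomorphisms: modulo a left multiplication, an endomorphism kills 1. Divisibility of `p + ν k` by
`p²` in `A`, for infinitely many `p`, then forces it to kill every `ν k`, hence everything
(`locallyFreeGroupMulLeft_surjective`). Faithfulness follows from local freeness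
(`isFaithful_locallyFreeGroup`).

The matrix ring qualifies, its first-row units other than the identity having square zero. Its only
asymmetric product is `v 1 * w 2` in column 3, which spoils right invariance; the symmetric products
in the last column carry every nonzero element into the center. -/

theorem exists_nat_infinite_prime_fibers :
    ∃ c : ℕ → ℕ, ∀ i, {p | p.Prime ∧ c p = i}.Infinite := by
  -- The prime with index `Nat.pair i k` receives the value `i`.
  refine ⟨fun p => (Nat.unpair (Nat.count Nat.Prime p)).1, fun i => ?_⟩
  refine Set.infinite_of_injective_forall_mem
    (f := fun k => Nat.nth Nat.Prime (Nat.pair i k)) ?_ fun k => ?_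
  · intro k l h
    simpa using Nat.nth_injective Nat.infinite_setOfPred_prime h
  · refine ⟨Nat.prime_nth_prime _, ?_⟩
    simp [Nat.count_nth_of_infinite Nat.infinite_setOfPred_prime]

/-! ### Localization of subgroups at primes -/

namespace AddSubgroup

/-- The localization of a subgroup `H` at `p` within the ambient group: the elements having a
multiple in `H` by an integer not divisible by `p`. -/
def primeLocalization {M : Type*} [AddCommGroup M] (H : AddSubgroup M) {p : ℕ} (hp : p.Prime) :
    AddSubgroup M where
  carrier := {x | ∃ m : ℤ, ¬ (p : ℤ) ∣ m ∧ m • x ∈ H}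
  zero_mem' := ⟨1, fun h => hp.not_dvd_one (by exact_mod_cast h), by simp⟩
  add_mem' := by
    rintro x y ⟨m, hm, hx⟩ ⟨k, hk, hy⟩
    refine ⟨m * k, fun h => ?_, ?_⟩
    · exact ((Nat.prime_iff_prime_int.1 hp).dvd_or_dvd h).elim hm hk
    · rw [smul_add]
      refine H.add_mem ?_ ?_
      · rw [mul_comm, mul_smul]
        exact H.zsmul_mem hx k
      · rw [mul_smul]
        exact H.zsmul_mem hy m
  neg_mem' := by
    rintro x ⟨m, hm, hx⟩
    exact ⟨m, hm, by simpa using hx⟩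

variable {M : Type*} [AddCommGroup M] {H : AddSubgroup M}

theorem le_primeLocalization {p : ℕ} (hp : p.Prime) : H ≤ H.primeLocalization hp :=
  fun x hx => ⟨1, fun h => hp.not_dvd_one (by exact_mod_cast h), by simpa using hx⟩

/-- The integers carrying `x` into `H` form an ideal that lies in no `pℤ`, so it contains 1. -/
theorem mem_of_forall_mem_primeLocalization {x : M}
    (h : ∀ (p : ℕ) (hp : p.Prime), x ∈ H.primeLocalization hp) : x ∈ H := by
  let J : Ideal ℤ :=
    { carrier := {m : ℤ | m • x ∈ H}
      zero_mem' := by simp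
      add_mem' := fun {a b} ha hb => by
        simpa [add_smul] using H.add_mem ha hb
      smul_mem' := fun c a ha => by
        simpa [mul_smul] using H.zsmul_mem ha c }
  have hJ : ∀ m : ℤ, m ∈ J ↔ m • x ∈ H := fun m => Iff.rfl
  suffices J = ⊤ by
    have h1 := (hJ 1).1 (this ▸ Submodule.mem_top)
    simpa using h1
  by_contra hne
  obtain ⟨P, hP, hJP⟩ := Ideal.exists_le_maximal J hne
  obtain ⟨g, hg⟩ := (IsPrincipalIdealRing.principal P).principal
  change P = Ideal.span {g} at hg
  obtain ⟨p, hp, hpg⟩ := Nat.exists_prime_and_dvd (n := g.natAbs) (fun hu => hP.ne_top (by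
    rw [hg]; exact Ideal.span_singleton_eq_top.2 (Int.isUnit_iff_natAbs_eq.2 hu)))
  obtain ⟨m, hm, hmx⟩ := h p hp
  have : m ∈ P := hJP ((hJ m).2 hmx)
  rw [hg, Ideal.mem_span_singleton] at this
  exact hm ((Int.natCast_dvd.2 hpg).trans this)

end AddSubgroup

/-! ### Groups locally free of rank one over a ring -/

section LocallyFreeGroup

variable {R K : Type*} [Ring R] [Ring K]

/-- For a subring `φ(R)` of `K` and elements `w p` of `R`, the group of all `x ∈ K` such that
`x * w p` lies in the localization of `φ(R)` at `p`, for every prime `p`. If `w p` is invertible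
in `K`, this group is locally at `p` the free `R`-module generated by the inverse of `w p`. -/
def locallyFreeGroup (φ : R →+* K) (w : ℕ → R) : AddSubgroup K where
  carrier := {x | ∀ (p : ℕ) (hp : p.Prime),
    x * φ (w p) ∈ φ.toAddMonoidHom.range.primeLocalization hp}
  zero_mem' := fun p hp => by rw [zero_mul]; exact AddSubgroup.zero_mem _
  add_mem' := fun hx hy p hp => by rw [add_mul]; exact AddSubgroup.add_mem _ (hx p hp) (hy p hp)
  neg_mem' := fun hx p hp => by rw [neg_mul]; exact AddSubgroup.neg_mem _ (hx p hp)

variable {φ : R →+* K} {w : ℕ → R}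

theorem map_mem_locallyFreeGroup (r : R) : φ r ∈ locallyFreeGroup φ w := fun p hp =>
  AddSubgroup.le_primeLocalization hp ⟨r * w p, map_mul φ _ _⟩

theorem map_mul_mem_locallyFreeGroup (r : R) {x : K} (hx : x ∈ locallyFreeGroup φ w) :
    φ r * x ∈ locallyFreeGroup φ w := by
  intro p hp
  obtain ⟨m, hm, s, hs⟩ := hx p hp
  refine ⟨m, hm, r * s, ?_⟩
  change φ s = _ at hs
  change φ (r * s) = _
  rw [map_mul, hs, mul_assoc, mul_smul_comm]

variable (φ w) in
/-- Left multiplication by elements of `R` on `locallyFreeGroup φ w`. -/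
def locallyFreeGroupMulLeft : R →+* AddMonoid.End (locallyFreeGroup φ w) where
  toFun r :=
    { toFun := fun x => ⟨φ r * x, map_mul_mem_locallyFreeGroup r x.2⟩
      map_zero' := Subtype.ext (mul_zero _)
      map_add' := fun x y => Subtype.ext (mul_add _ _ _) }
  map_one' := by ext x; exact (congrArg (· * (x : K)) (map_one φ)).trans (one_mul _)
  map_mul' r s := by ext x; exact (congrArg (· * (x : K)) (map_mul φ r s)).trans (mul_assoc _ _ _)
  map_zero' := by ext x; exact (congrArg (· * (x : K)) (map_zero φ)).trans (zero_mul _)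
  map_add' r s := by ext x; exact (congrArg (· * (x : K)) (map_add φ r s)).trans (add_mul _ _ _)

theorem coe_locallyFreeGroupMulLeft (r : R) (x : locallyFreeGroup φ w) :
    (locallyFreeGroupMulLeft φ w r x : K) = φ r * x := rfl

theorem locallyFreeGroupMulLeft_injective (hφ : Function.Injective φ) :
    Function.Injective (locallyFreeGroupMulLeft φ w) := by
  intro r s h
  have h1 := congrArg Subtype.val (DFunLike.congr_fun h ⟨φ 1, map_mem_locallyFreeGroup 1⟩)
  rw [coe_locallyFreeGroupMulLeft, coe_locallyFreeGroupMulLeft, ← map_mul, ← map_mul, mul_one,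
    mul_one] at h1
  exact hφ h1

/-- An element of `K` whose left multiplication preserves the group comes from `R`. -/
theorem mem_range_of_mul_mem_locallyFreeGroup
    (hu : ∀ p : ℕ, p.Prime → ∃ u ∈ locallyFreeGroup φ w, u * φ (w p) = 1) {a : K}
    (ha : ∀ x ∈ locallyFreeGroup φ w, a * x ∈ locallyFreeGroup φ w) : ∃ r, φ r = a := by
  suffices a ∈ φ.toAddMonoidHom.range from this
  refine AddSubgroup.mem_of_forall_mem_primeLocalization fun p hp => ?_
  obtain ⟨u, hu, huw⟩ := hu p hp
  -- Here `a = (a * u) * φ (w p)` with `a * u` in the group.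
  simpa [mul_assoc, huw] using ha u hu p hp

/-- As every endomorphism is a left multiplication, `I` corresponds to a right ideal `J` of `R`, and
`IA * w p` lies in `J_(p)`. If `IA = A`, the inverse of `w p` puts 1 in every `J_(p)`, hence in `J`.
-/
theorem isFaithful_locallyFreeGroup (hφ : Function.Injective φ)
    (hu : ∀ p : ℕ, p.Prime → ∃ u ∈ locallyFreeGroup φ w, u * φ (w p) = 1)
    (hsurj : Function.Surjective (locallyFreeGroupMulLeft φ w)) :
    IsFaithfulAbelianGroup (locallyFreeGroup φ w) := by
  intro I hI htop
  apply hI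
  let J : AddSubgroup R := I.toAddSubgroup.comap (locallyFreeGroupMulLeft φ w).toAddMonoidHom
  have hJ : ∀ r, r ∈ J ↔ locallyFreeGroupMulLeft φ w r ∈ I := fun r => Iff.rfl
  have key : ∀ (p : ℕ) (hp : p.Prime), ∀ b ∈ rightIdealImage I,
      (b : K) * φ (w p) ∈ (J.map φ.toAddMonoidHom).primeLocalization hp := by
    intro p hp b hb
    induction hb using AddSubgroup.closure_induction with
    | mem b hb =>
      obtain ⟨f, hf, a, rfl⟩ := hb
      obtain ⟨r, rfl⟩ := hsurj f
      obtain ⟨m, hm, s, hs⟩ := a.2 p hp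
      refine ⟨m, hm, r * s, ?_, ?_⟩
      · rw [SetLike.mem_coe, hJ, map_mul]
        exact I.smul_mem (MulOpposite.op (locallyFreeGroupMulLeft φ w s)) hf
      · change φ s = _ at hs
        change φ (r * s) = _
        rw [map_mul, hs, coe_locallyFreeGroupMulLeft, mul_assoc, mul_smul_comm]
    | zero => rw [AddSubgroup.coe_zero, zero_mul]; exact AddSubgroup.zero_mem _
    | add x y _ _ hx hy =>
      rw [AddSubgroup.coe_add, add_mul]; exact AddSubgroup.add_mem _ hx hy
    | neg x _ hx => rw [AddSubgroup.coe_neg, neg_mul]; exact AddSubgroup.neg_mem _ hx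
  have h1 : (1 : K) ∈ J.map φ.toAddMonoidHom := by
    refine AddSubgroup.mem_of_forall_mem_primeLocalization fun p hp => ?_
    obtain ⟨u, hu, huw⟩ := hu p hp
    have := key p hp ⟨u, hu⟩ (htop ▸ AddSubgroup.mem_top _)
    rwa [huw] at this
  obtain ⟨r, hr, hr1⟩ := h1
  obtain rfl : r = 1 := hφ (hr1.trans (map_one φ).symm)
  have h1I : (1 : AddMonoid.End (locallyFreeGroup φ w)) ∈ I := by
    have := (hJ 1).1 hr
    rwa [map_one] at this
  refine (Submodule.eq_top_iff').2 fun f => ?_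
  simpa using I.smul_mem (MulOpposite.op f) h1I

/-- The image of `R` lies in the group with torsion quotient. -/
theorem rank_locallyFreeGroup {R K : Type} [Ring R] [Ring K] {φ : R →+* K} {w : ℕ → R}
    (hφ : Function.Injective φ)
    (hden : ∀ x : K, ∃ m : ℤ, m ≠ 0 ∧ ∃ r, φ r = m • x) :
    Module.rank ℤ (locallyFreeGroup φ w) = Module.rank ℤ R := by
  let i : R →ₗ[ℤ] locallyFreeGroup φ w := AddMonoidHom.toIntLinearMap
    (φ.toAddMonoidHom.codRestrict (locallyFreeGroup φ w) map_mem_locallyFreeGroup)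
  have hi : ∀ r, (i r : K) = φ r := fun r => rfl
  have hinj : Function.Injective i := fun r s h => hφ (by rw [← hi, ← hi, h])
  rw [← Submodule.rank_quotient_add_rank (LinearMap.range i),
    ← (LinearEquiv.ofInjective i hinj).rank_eq]
  suffices Module.rank ℤ (locallyFreeGroup φ w ⧸ LinearMap.range i) = 0 by rw [this, zero_add]
  rw [Module.rank_eq_zero_iff_isTorsion]
  intro x
  obtain ⟨x, rfl⟩ := Submodule.Quotient.mk_surjective (LinearMap.range i) x
  obtain ⟨m, hm, r, hr⟩ := hden x
  refine ⟨⟨m, mem_nonZeroDivisors_of_ne_zero hm⟩, ?_⟩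
  change m • Submodule.Quotient.mk (p := LinearMap.range i) x = 0
  rw [← Submodule.Quotient.mk_smul, Submodule.Quotient.mk_eq_zero]
  exact ⟨r, Subtype.ext (by rw [hi, hr]; rfl)⟩

/-- An element of `K` divisible by infinitely many primes `p` in the localization of `φ(R)` at `p`
vanishes. -/
theorem eq_zero_of_infinite_prime_dvd [Module.Free ℤ R] [IsAddTorsionFree K]
    (hφ : Function.Injective φ) (hden : ∀ x : K, ∃ m : ℤ, m ≠ 0 ∧ ∃ r, φ r = m • x) {z : K}
    {P : Set ℕ} (hP : P.Infinite)
    (hz : ∀ p ∈ P, ∃ hp : p.Prime, ∃ y ∈ φ.toAddMonoidHom.range.primeLocalization hp,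
      z = (p : ℤ) • y) : z = 0 := by
  obtain ⟨d, hd, r, hr⟩ := hden z
  suffices r = 0 by
    rw [this, map_zero] at hr
    exact (smul_eq_zero.1 hr.symm).resolve_left hd
  let b := Module.Free.chooseBasis ℤ R
  refine b.ext_elem fun i => ?_
  rw [map_zero, Finsupp.zero_apply]
  -- Every prime in `P` divides this coordinate of `r`, and a nonzero integer has only finitely many
  -- divisors.
  refine Int.natAbs_eq_zero.1 (by_contra fun hne => hP ?_)
  refine (Finset.finite_toSet (b.repr r i).natAbs.divisors).subset fun p hpP => ?_
  rw [Finset.mem_coe, Nat.mem_divisors]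
  refine ⟨?_, hne⟩
  obtain ⟨hp, y, ⟨m, hm, s, hs⟩, hy⟩ := hz p hpP
  have h : m • r = (p : ℤ) • d • s := hφ (by
    change φ s = _ at hs
    rw [map_zsmul, map_zsmul, map_zsmul, hr, hs, hy]
    simp only [smul_smul]
    congr 1
    ring)
  have h' := DFunLike.congr_fun (congrArg b.repr h) i
  simp only [map_smul, Finsupp.smul_apply, smul_eq_mul] at h'
  exact Int.natCast_dvd.1 (((Nat.prime_iff_prime_int.1 hp).dvd_or_dvd
    (Dvd.intro _ h'.symm)).resolve_left hm)

end LocallyFreeGroup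

/-! ### Realization of rings spanned by 1 and square-zero elements -/

section SquareZeroGenerators

variable {R K : Type*} [Ring R] [Ring K] [Algebra ℚ K] {φ : R →+* K} {ν : ℕ → R} {c : ℕ → ℕ}

/-- Since `ν² = 0`, `(p + ν)(p - ν) = p²`. At primes other than `p` the denominator `p²` is
harmless. -/
theorem exists_inverse_mem_locallyFreeGroup (hν : ∀ k, ν k * ν k = 0) {p : ℕ} (hp : p.Prime) :
    ∃ u ∈ locallyFreeGroup φ fun q => (q : R) - ν (c q),
      u * φ (p - ν (c p)) = 1 ∧ (p ^ 2 : ℤ) • u = φ (p + ν (c p)) := by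
  have hp0 : (p : ℚ) ^ 2 ≠ 0 := pow_ne_zero 2 (by exact_mod_cast hp.ne_zero)
  let u : K := ((p : ℚ) ^ 2)⁻¹ • φ (p + ν (c p))
  have hu : (p ^ 2 : ℤ) • u = φ (p + ν (c p)) := by
    rw [← Int.cast_smul_eq_zsmul ℚ]
    push_cast
    exact smul_inv_smul₀ hp0 _
  have huw : u * φ (p - ν (c p)) = 1 := by
    have h : ((p : R) + ν (c p)) * (p - ν (c p)) = (p ^ 2 : ℕ) := by
      rw [add_mul, mul_sub, mul_sub, hν, Nat.cast_comm p (ν (c p))]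
      push_cast
      noncomm_ring
    rw [smul_mul_assoc, ← map_mul, h, map_natCast, inv_smul_eq_iff₀ hp0, ← Nat.cast_pow,
      Nat.cast_smul_eq_nsmul, nsmul_one]
  refine ⟨u, fun q hq => ?_, huw, hu⟩
  by_cases hqp : q = p
  · subst hqp
    exact AddSubgroup.le_primeLocalization hq ⟨1, (map_one φ).trans huw.symm⟩
  · refine ⟨p ^ 2, fun h => hqp ?_, ?_⟩
    · exact (Nat.prime_dvd_prime_iff_eq hq hp).1
        (by exact_mod_cast (Nat.prime_iff_prime_int.1 hq).dvd_of_dvd_pow h)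
    · rw [← smul_mul_assoc, hu, ← map_mul]
      exact ⟨_, rfl⟩

/-- With `a = f 1` and `g x = f x - a * x`, the relation `p² u = p + ν` gives `p² g(u) = g(ν)`, so
`g(ν) (p - ν)` lies in `p² R_(p)` for almost all `p` assigned to `ν`. -/
theorem locallyFreeGroupMulLeft_surjective [Module.Free ℤ R] (hφ : Function.Injective φ)
    (hden : ∀ x : K, ∃ m : ℤ, m ≠ 0 ∧ ∃ r, φ r = m • x) (hν : ∀ k, ν k * ν k = 0)
    (hspan : Submodule.span ℤ (insert 1 (Set.range ν)) = ⊤)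
    (hc : ∀ i, {p | p.Prime ∧ c p = i}.Infinite) :
    Function.Surjective (locallyFreeGroupMulLeft φ fun q => (q : R) - ν (c q)) := by
  have : IsAddTorsionFree K := .of_module_rat K
  intro f
  let i : R →+ locallyFreeGroup φ fun q => (q : R) - ν (c q) :=
    φ.toAddMonoidHom.codRestrict _ map_mem_locallyFreeGroup
  have hi : ∀ r, (i r : K) = φ r := fun r => rfl
  let a : K := f (i 1)
  let g : (locallyFreeGroup φ fun q => (q : R) - ν (c q)) →+ K :=
    (AddSubgroup.subtype _).comp f -
      (AddMonoidHom.mulLeft a).comp (AddSubgroup.subtype _)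
  have hg : ∀ x, g x = f x - a * x := fun x => rfl
  have hg1 : g (i 1) = 0 := by rw [hg, hi, map_one φ, mul_one, sub_self]
  have hgν : ∀ k, g (i (ν k)) = 0 := by
    intro k
    obtain ⟨d, hd, r, hr⟩ := hden a
    obtain ⟨e, he, s, hs⟩ := hden (g (i (ν k)))
    -- Away from the divisors of `d * e`, both `a` and `g (ν k)` lie in `R_(p)`.
    have hP : ({p | p.Prime ∧ c p = k} \ ↑(d * e).natAbs.divisors).Infinite :=
      (hc k).sdiff (Finset.finite_toSet _)
    have main : ∀ p ∈ {p | p.Prime ∧ c p = k} \ ↑(d * e).natAbs.divisors, ∃ hp : p.Prime,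
        g (i (ν k)) ∈ φ.toAddMonoidHom.range.primeLocalization hp ∧
        ∃ y ∈ φ.toAddMonoidHom.range.primeLocalization hp,
          (p : ℤ) • g (i (ν k)) - g (i (ν k)) * φ (ν k) = (p : ℤ) • (p : ℤ) • y := by
      rintro p ⟨⟨hp, rfl⟩, hpd⟩
      have hpd : ¬ (p : ℤ) ∣ d * e := fun h => hpd (by
        rw [Finset.mem_coe, Nat.mem_divisors]
        exact ⟨Int.natCast_dvd.1 h, Int.natAbs_ne_zero.2 (mul_ne_zero hd he)⟩)
      obtain ⟨u, hu, huw, hpu⟩ := exists_inverse_mem_locallyFreeGroup (φ := φ) (c := c) hν hp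
      refine ⟨hp, ⟨e, fun h => hpd (h.mul_left d), s, hs⟩,
        g ⟨u, hu⟩ * φ (p - ν (c p)), ?_, ?_⟩
      · rw [hg, sub_mul, mul_assoc, huw, mul_one]
        exact AddSubgroup.sub_mem _ ((f ⟨u, hu⟩).2 p hp)
          ⟨d, fun h => hpd (h.mul_right e), r, hr⟩
      · have h1 : (p ^ 2 : ℤ) • (⟨u, hu⟩ : locallyFreeGroup φ fun q => (q : R) - ν (c q)) =
            (p : ℤ) • i 1 + i (ν (c p)) := by
          refine Subtype.ext ?_
          rw [AddSubgroup.coe_zsmul, hpu, AddSubgroup.coe_add, AddSubgroup.coe_zsmul, hi, hi,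
            map_add, map_natCast, map_one, zsmul_one, Int.cast_natCast]
        have h2 := congrArg g h1
        rw [map_zsmul, map_add, map_zsmul, hg1, smul_zero, zero_add] at h2
        rw [smul_smul, ← sq, ← smul_mul_assoc, h2, map_sub, map_natCast, mul_sub,
          ← Nat.cast_comm, natCast_zsmul, nsmul_eq_mul]
    -- Reducing the relation modulo `p` kills `g(ν) ν`; what remains is `p g(ν) = p² y`, so `g(ν)`
    -- is itself divisible by `p`.
    have hz : g (i (ν k)) * φ (ν k) = 0 := by
      refine eq_zero_of_infinite_prime_dvd hφ hden hP fun p hpP => ?_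
      obtain ⟨hp, hm, y, hy, h⟩ := main p hpP
      refine ⟨hp, _, AddSubgroup.sub_mem _ hm (AddSubgroup.zsmul_mem _ hy p), ?_⟩
      rw [smul_sub, ← h, sub_sub_cancel]
    refine eq_zero_of_infinite_prime_dvd hφ hden hP fun p hpP => ?_
    obtain ⟨hp, -, y, hy, h⟩ := main p hpP
    refine ⟨hp, y, hy, ?_⟩
    rw [hz, sub_zero] at h
    exact smul_right_injective K (by exact_mod_cast hp.ne_zero : (p : ℤ) ≠ 0) h
  have hgi : ∀ r, g (i r) = 0 := by
    intro r
    have hr : r ∈ Submodule.span ℤ (insert 1 (Set.range ν)) := hspan ▸ Submodule.mem_top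
    induction hr using Submodule.span_induction with
    | mem x hx =>
      obtain rfl | ⟨k, rfl⟩ := hx
      · exact hg1
      · exact hgν k
    | zero => simp
    | add x y _ _ hx hy => rw [map_add, map_add, hx, hy, add_zero]
    | smul m x _ hx => rw [map_zsmul, map_zsmul, hx, smul_zero]
  -- A multiple of `x` lies in `R`, where `g` vanishes, and `K` is torsion-free.
  have hf : ∀ x, (f x : K) = a * x := by
    intro x
    obtain ⟨m, hm, r, hr⟩ := hden x
    have h : i r = m • x := Subtype.ext hr
    have := hgi r
    rw [h, map_zsmul] at this
    exact sub_eq_zero.1 ((smul_eq_zero.1 this).resolve_left hm)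
  obtain ⟨r, hr⟩ := mem_range_of_mul_mem_locallyFreeGroup (φ := φ)
    (w := fun q => (q : R) - ν (c q)) (a := a)
    (fun p hp => by
      obtain ⟨u, hu, huw, -⟩ := exists_inverse_mem_locallyFreeGroup (φ := φ) (c := c) hν hp
      exact ⟨u, hu, huw⟩)
    (fun x hx => hf ⟨x, hx⟩ ▸ (f ⟨x, hx⟩).2)
  refine ⟨r, ?_⟩
  ext x
  rw [coe_locallyFreeGroupMulLeft, hf, hr]

open TensorProduct in
/-- A ring with free additive group that is generated additively by `1` and elements of square
zero is the endomorphism ring of a faithful torsion-free Abelian group of the same rank. -/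
theorem exists_faithful_group_of_square_zero_generators {R : Type} [Ring R] [Module.Free ℤ R]
    {ν : ℕ → R} (hν : ∀ k, ν k * ν k = 0)
    (hspan : Submodule.span ℤ (insert 1 (Set.range ν)) = ⊤) :
    ∃ (A : Type) (_ : AddCommGroup A), IsAddTorsionFree A ∧
      Module.rank ℤ A = Module.rank ℤ R ∧ IsFaithfulAbelianGroup A ∧
      Nonempty (R ≃+* AddMonoid.End A) := by
  obtain ⟨c, hc⟩ := exists_nat_infinite_prime_fibers
  let φ : R →+* ℚ ⊗[ℤ] R := (Algebra.TensorProduct.includeRight : R →ₐ[ℤ] ℚ ⊗[ℤ] R)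
  have hφ : Function.Injective φ :=
    Algebra.TensorProduct.includeRight_injective (RingHom.injective_int _)
  have hden : ∀ x : ℚ ⊗[ℤ] R, ∃ m : ℤ, m ≠ 0 ∧ ∃ r, φ r = m • x := by
    have : IsLocalizedModule (nonZeroDivisors ℤ) (TensorProduct.mk ℤ ℚ R 1) :=
      (isLocalizedModule_iff_isBaseChange (nonZeroDivisors ℤ) ℚ _).2
        (TensorProduct.isBaseChange ℤ R ℚ)
    intro x
    obtain ⟨⟨r, m⟩, h⟩ := IsLocalizedModule.surj (nonZeroDivisors ℤ) (TensorProduct.mk ℤ ℚ R 1) x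
    exact ⟨m, nonZeroDivisors.ne_zero m.2, r, h.symm⟩
  have hK : IsAddTorsionFree (ℚ ⊗[ℤ] R) := .of_module_rat _
  have hsurj := locallyFreeGroupMulLeft_surjective hφ hden hν hspan hc
  refine ⟨locallyFreeGroup φ fun q => (q : R) - ν (c q), inferInstance, inferInstance,
    rank_locallyFreeGroup hφ hden, isFaithful_locallyFreeGroup hφ (fun p hp => ?_) hsurj,
    ⟨RingEquiv.ofBijective _ ⟨locallyFreeGroupMulLeft_injective hφ, hsurj⟩⟩⟩
  obtain ⟨u, hu, huw, -⟩ := exists_inverse_mem_locallyFreeGroup (φ := φ) (c := c) hν hp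
  exact ⟨u, hu, huw⟩

end SquareZeroGenerators

/-! ### Arithmetic of the matrix ring through first rows -/

section PatternRing

variable {R : Type*} [CommRing R] {n : ℕ}

/-- The element of `patternRing R n hn` with first row `v 0, …, v (n - 1)`. -/
def patternElem (hn : 7 ≤ n) (v : ℕ → R) : patternRing R n hn := ⟨patternMatrix n v, v, rfl⟩

/-- The first row of the product of the pattern matrices with first rows `v` and `w`. -/
def patternMulRow (n : ℕ) (v w : ℕ → R) (j : ℕ) : R :=
  v 0 * w j + (if j = 0 then 0 else v j * w 0) + (if j = 3 then v 1 * w 2 else 0) +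
    (if j = n - 1 then v 1 * w (n - 3) + v 2 * w (n - 2) + v (n - 3) * w 1 + v (n - 2) * w 2
      else 0)

variable {hn : 7 ≤ n}

theorem exists_eq_patternElem (x : patternRing R n hn) : ∃ v, x = patternElem hn v := by
  obtain ⟨_, v, rfl⟩ := x
  exact ⟨v, rfl⟩

theorem patternElem_inj {v w : ℕ → R} :
    patternElem hn v = patternElem hn w ↔ ∀ j < n, v j = w j := by
  constructor
  · intro h j hj
    have := congrFun (congrFun (congrArg Subtype.val h) ⟨0, by omega⟩) ⟨j, hj⟩
    simpa [patternElem, patternMatrix, patternEntry_first_row] using this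
  · intro h
    refine Subtype.ext ?_
    ext ⟨i, hi⟩ ⟨j, hj⟩
    simp only [patternElem, patternMatrix, Matrix.of_apply, patternEntry]
    split_ifs <;> first | rfl | exact h _ (by omega)

theorem patternElem_mul (v w : ℕ → R) :
    patternElem hn v * patternElem hn w = patternElem hn (patternMulRow n v w) := by
  obtain ⟨u, hu⟩ := patternMatrix_mul hn v w
  have huu : patternElem hn v * patternElem hn w = patternElem hn u := Subtype.ext hu
  rw [huu, patternElem_inj]
  intro j hj
  have h := congrFun (congrFun hu ⟨0, by omega⟩) ⟨j, hj⟩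
  simp only [patternMatrix, Matrix.mul_apply, Matrix.of_apply, patternEntry_first_row] at h
  rw [Fin.sum_univ_eq_sum_range (fun k => v k * patternEntry n w k j) n] at h
  rw [← h]
  -- One summand for each possible nonzero entry of column `j`: first row, diagonal, and the five
  -- repeated entries. For `j = 0` the first two coincide, so the diagonal one is dropped.
  have e : ∀ k, v k * patternEntry n w k j =
      (if k = 0 then v k * w j else 0) + (if k = j then (if j = 0 then 0 else v j * w 0) else 0) +
      (if k = 1 then (if j = 3 then v 1 * w 2 else 0) else 0) +
      (if k = 1 then (if j = n - 1 then v 1 * w (n - 3) else 0) else 0) +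
      (if k = 2 then (if j = n - 1 then v 2 * w (n - 2) else 0) else 0) +
      (if k = n - 3 then (if j = n - 1 then v (n - 3) * w 1 else 0) else 0) +
      (if k = n - 2 then (if j = n - 1 then v (n - 2) * w 2 else 0) else 0) := by
    intro k
    simp only [patternEntry]
    split_ifs <;> first | (exfalso; omega) | (subst_vars; simp)
  have h0 : 0 < n := by omega
  have h1 : 1 < n := by omega
  have h2 : 2 < n := by omega
  have h3 : n - 3 < n := by omega
  have h4 : n - 2 < n := by omega
  simp only [e, Finset.sum_add_distrib, Finset.sum_ite_eq', Finset.mem_range, patternMulRow, hj,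
    h0, h1, h2, h3, h4, if_true]
  by_cases hl : j = n - 1
  · simp only [if_pos hl]
    ring
  · simp only [if_neg hl]
    ring

theorem patternElem_add (v w : ℕ → R) :
    patternElem hn (v + w) = patternElem hn v + patternElem hn w := by
  refine Subtype.ext ?_
  ext i j
  simp only [patternElem, patternMatrix, patternEntry, Matrix.of_apply, Matrix.add_apply,
    Pi.add_apply, AddMemClass.mk_add_mk]
  split_ifs <;> simp

theorem patternElem_zero : patternElem hn (0 : ℕ → R) = 0 := by
  refine Subtype.ext ?_
  ext i j
  simp [patternElem, patternMatrix, patternEntry]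

theorem patternElem_single_zero : patternElem hn (Pi.single 0 (1 : R)) = 1 := by
  refine Subtype.ext ?_
  ext i j
  simp only [patternElem, patternMatrix, patternEntry, Matrix.of_apply, OneMemClass.coe_one,
    Matrix.one_apply, Fin.ext_iff, Pi.single_apply]
  split_ifs <;> first | rfl | (exfalso; omega)

theorem patternElem_eq_zero {v : ℕ → R} : patternElem hn v = 0 ↔ ∀ j < n, v j = 0 := by
  rw [← patternElem_zero, patternElem_inj]
  rfl

/-- The square of a matrix unit pattern other than the identity vanishes. -/
theorem patternElem_single_sq (k : ℕ) :
    patternElem hn (Pi.single (k + 1) (1 : R)) * patternElem hn (Pi.single (k + 1) 1) = 0 := by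
  rw [patternElem_mul, patternElem_eq_zero]
  intro j hj
  simp only [patternMulRow, Pi.single_apply]
  -- Apart from the terms involving `v 0` or `w 0`, products pair distinct indices, as `n - 3 > 2`.
  split_ifs <;> first | (exfalso; omega) | simp

/-- The product of first rows is symmetric except for `v 1 * w 2` in column 3. -/
theorem patternElem_mem_center {v : ℕ → R} (h1 : v 1 = 0) (h2 : v 2 = 0) :
    patternElem hn v ∈ Subring.center (patternRing R n hn) := by
  rw [Subring.mem_center_iff]
  intro g
  obtain ⟨w, rfl⟩ := exists_eq_patternElem g
  rw [patternElem_mul, patternElem_mul, patternElem_inj]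
  intro j hj
  simp only [patternMulRow, h1, h2]
  split_ifs <;> (subst_vars; ring)

/-- If `v 1` or `v 2` is nonzero, multiplying by the central unit at `n - 3` or `n - 2` respectively
places it in the last column; the product has zero entries 1 and 2, so it is central. -/
theorem isCentrallyEssential_patternRing [Nontrivial R] :
    IsCentrallyEssential (patternRing R n hn) := by
  intro a ha
  obtain ⟨v, rfl⟩ := exists_eq_patternElem a
  by_cases h1 : v 1 = 0
  · by_cases h2 : v 2 = 0
    · refine ⟨1, Subring.one_mem _, _, patternElem_mem_center h1 h2, ?_, ha, mul_one _⟩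
      intro h
      exact ha (by rw [← mul_one (patternElem hn v), h, mul_zero])
    · refine ⟨patternElem hn (Pi.single (n - 2) 1), patternElem_mem_center ?_ ?_, _, ?_, ?_, ?_,
        patternElem_mul _ _⟩
      · exact Pi.single_eq_of_ne (by omega) _
      · exact Pi.single_eq_of_ne (by omega) _
      · apply patternElem_mem_center <;> simp only [patternMulRow, Pi.single_apply] <;>
          split_ifs <;> first | (exfalso; omega) | simp
      · rw [Ne, patternElem_eq_zero]
        intro h
        simpa using h (n - 2) (by omega)
      · rw [Ne, patternElem_eq_zero]
        intro h
        refine h2 ?_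
        have := h (n - 1) (by omega)
        simp only [patternMulRow, Pi.single_apply] at this
        split_ifs at this <;> first | (exfalso; omega) | simpa using this
  · refine ⟨patternElem hn (Pi.single (n - 3) 1), patternElem_mem_center ?_ ?_, _, ?_, ?_, ?_,
      patternElem_mul _ _⟩
    · exact Pi.single_eq_of_ne (by omega) _
    · exact Pi.single_eq_of_ne (by omega) _
    · apply patternElem_mem_center <;> simp only [patternMulRow, Pi.single_apply] <;>
        split_ifs <;> first | (exfalso; omega) | simp
    · rw [Ne, patternElem_eq_zero]
      intro h
      simpa using h (n - 3) (by omega)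
    · rw [Ne, patternElem_eq_zero]
      intro h
      refine h1 ?_
      have := h (n - 1) (by omega)
      simp only [patternMulRow, Pi.single_apply] at this
      split_ifs at this <;> first | (exfalso; omega) | simpa using this

/-- Let `e k` be the element with first row `Pi.single k 1`. Then `e 1 * e 2 = e 3`, while every
element of `e 2 * R` has zero in column 3 of its first row. -/
theorem not_isRightInvariant_patternRing [Nontrivial R] :
    ¬ IsRightInvariant (patternRing R n hn) := by
  intro h
  have := h (Submodule.span _ {patternElem hn (Pi.single 2 1)}) (patternElem hn (Pi.single 1 1))
    (patternElem hn (Pi.single 2 1)) (Submodule.mem_span_singleton_self _)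
  rw [Submodule.mem_span_singleton] at this
  obtain ⟨s, hs⟩ := this
  obtain ⟨w, hw⟩ := exists_eq_patternElem s.unop
  rw [← MulOpposite.op_unop s, op_smul_eq_mul, hw, patternElem_mul, patternElem_mul,
    patternElem_inj] at hs
  have h3 := hs 3 (by omega)
  simp only [patternMulRow, Pi.single_apply] at h3
  split_ifs at h3 <;> first | (exfalso; omega) | simp at h3

theorem patternElem_smul (m : ℤ) (v : ℕ → ℤ) :
    patternElem hn (m • v) = m • patternElem hn v := by
  refine Subtype.ext ?_
  ext i j
  simp only [patternElem, patternMatrix, patternEntry, Matrix.of_apply, Pi.smul_apply,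
    Matrix.smul_apply, AddSubgroupClass.coe_zsmul]
  split_ifs <;> simp

/-- A pattern matrix is determined by its first row. -/
noncomputable def patternRowEquiv (hn : 7 ≤ n) : (Fin n → ℤ) ≃ₗ[ℤ] patternRing ℤ n hn :=
  LinearEquiv.ofBijective
    { toFun := fun v => patternElem hn (Function.extend Fin.val v 0)
      map_add' := fun v w => by
        rw [← patternElem_add, patternElem_inj]
        intro j hj
        have := fun z : Fin n → ℤ => Fin.val_injective.extend_apply z 0 ⟨j, hj⟩
        simp only at this
        simp [this]
      map_smul' := fun m v => by
        rw [RingHom.id_apply, ← patternElem_smul, patternElem_inj]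
        intro j hj
        have := fun z : Fin n → ℤ => Fin.val_injective.extend_apply z 0 ⟨j, hj⟩
        simp only at this
        simp [this] } <| by
    refine ⟨fun v w h => funext fun j => ?_, fun x => ?_⟩
    · have := patternElem_inj.1 h j j.2
      rwa [Fin.val_injective.extend_apply, Fin.val_injective.extend_apply] at this
    · obtain ⟨v, rfl⟩ := exists_eq_patternElem x
      refine ⟨fun j => v j, patternElem_inj.2 fun j hj => ?_⟩
      exact Fin.val_injective.extend_apply _ 0 ⟨j, hj⟩

theorem span_patternElem_single :
    Submodule.span ℤ (insert 1 (Set.range fun k => patternElem hn (Pi.single (k + 1) (1 : ℤ)))) =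
      ⊤ := by
  rw [Submodule.eq_top_iff']
  intro x
  obtain ⟨v, rfl⟩ := exists_eq_patternElem x
  have h : patternElem hn v =
      ∑ k ∈ Finset.range n, v k • patternElem hn (Pi.single k (1 : ℤ)) := by
    let F : (ℕ → ℤ) →+ patternRing ℤ n hn :=
      ⟨⟨patternElem hn, patternElem_zero⟩, patternElem_add⟩
    have hF : ∀ v, F v = patternElem hn v := fun _ => rfl
    simp only [← hF, ← map_zsmul]
    rw [← map_sum, hF, hF, patternElem_inj]
    intro j hj
    simp [Finset.sum_apply, Pi.single_apply, hj]
  rw [h]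
  refine Submodule.sum_mem _ fun k _ => Submodule.smul_mem _ _ (Submodule.subset_span ?_)
  cases k with
  | zero => exact Or.inl patternElem_single_zero
  | succ k => exact Or.inr ⟨k, rfl⟩

end PatternRing

/-! ### Invariance under ring isomorphism -/

section Transport

variable {R S : Type*} [Ring R] [Ring S]

theorem RingEquiv.map_mem_center (e : R ≃+* S) {x : R} (hx : x ∈ Subring.center R) :
    e x ∈ Subring.center S := by
  rw [Subring.mem_center_iff] at hx ⊢
  intro s
  obtain ⟨r, rfl⟩ := e.surjective s
  rw [← map_mul, ← map_mul, hx]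

theorem IsCentrallyEssential.of_ringEquiv (e : R ≃+* S) (h : IsCentrallyEssential R) :
    IsCentrallyEssential S := by
  intro a ha
  obtain ⟨x, hx, y, hy, hx0, hy0, hxy⟩ := h (e.symm a) (by simpa using ha)
  refine ⟨e x, e.map_mem_center hx, e y, e.map_mem_center hy, by simpa using hx0,
    by simpa using hy0, ?_⟩
  rw [← hxy, map_mul, e.apply_symm_apply]

theorem IsRightInvariant.of_ringEquiv (e : R ≃+* S) (h : IsRightInvariant R) :
    IsRightInvariant S := by
  intro I r x hx
  let J : Submodule Rᵐᵒᵖ R :=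
    { I.toAddSubmonoid.comap (e : R →+ S) with
      smul_mem' := fun c y hy => by
        change e (y * c.unop) ∈ I
        rw [map_mul]
        exact I.smul_mem (MulOpposite.op (e c.unop)) hy }
  have hJ : ∀ y, y ∈ J ↔ e y ∈ I := fun y => Iff.rfl
  simpa [hJ] using h J (e.symm r) (e.symm x) (by simpa [hJ] using hx)

end Transport

theorem corollary4p4 (n : ℕ) (hn : 7 ≤ n) :
    ∃ (A : Type) (_ : AddCommGroup A),
      IsAddTorsionFree A ∧
      Module.rank ℤ A = n ∧
      IsFaithfulAbelianGroup A ∧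
      IsCentrallyEssential (AddMonoid.End A) ∧
      ¬ IsRightInvariant (AddMonoid.End A) ∧
      Nonempty (AddMonoid.End A ≃+* patternRing ℤ n hn) := by
  have : Module.Free ℤ (patternRing ℤ n hn) := Module.Free.of_equiv (patternRowEquiv hn)
  obtain ⟨A, _, htf, hrank, hfaithful, ⟨e⟩⟩ :=
    exists_faithful_group_of_square_zero_generators patternElem_single_sq
      (span_patternElem_single (hn := hn))
  refine ⟨A, _, htf, ?_, hfaithful, isCentrallyEssential_patternRing.of_ringEquiv e,
    fun h => not_isRightInvariant_patternRing (h.of_ringEquiv e.symm), ⟨e.symm⟩⟩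
  rw [hrank, ← (patternRowEquiv hn).rank_eq, rank_fun', Fintype.card_fin]
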